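/- **Theorem 4 (Strong dynamical localization II).** Let $\mathcal A_1$ be the CAR algebra over $\ell^2(\mathbb Z)$, i.e. the $C^*$-algebra generated by $1$ and the annihilation operators $c(f)$, $f\in\ell^2(\mathbb Z)$, on fermionic Fock space, with $\{c(f),c^*(g)\}=\langle f,g\rangle 1$ and $\{c(f),c(g)\}=0$. For $x\in\mathbb Z$ let $a_x^+=c^*(\delta_x)+c(\delta_x)$ and $a_x^-=i\,(c^*(\delta_x)-c(\delta_x))$ be the Majorana fermions. For a linear functional $\omega$ on $\mathcal A_1$ and a family $\tau=\{\tau_t\}_{t\in\mathbb R}$ of ($*$-)automorphisms of $\mathcal A_1$ write $a_x^\#(t)=\tau_t(a_x^\#)$. The pair $(\omega,\tau)$ is called quasi-free if $$\omega\big(a_{x_1}^{\#_1}(t_1)\cdots a_{x_{2n}}^{\#_{2n}}(t_{2n})\big)=\mathrm{pf}\big(\omega(a_{x_j}^{\#_j}(t_j)\,a_{x_k}^{\#_k}(t_k))\big)_{1\le j<k\le 2n}$$ for all $n\ge 1$, all $(x_1,\#_1),\dots,(x_{2n},\#_{2n})\in\mathbb Z\times\{\pm\}$ and all $t_1,\dots,t_{2n}\in\mathbb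 R$. Here $\mathrm{pf}$ is the pfaffian of the skew-symmetric matrix identified with the triangular array. For all $C,\mu\in(0,\infty)$ there is a constant $C'=C'(C,\mu)\in(0,\infty)$ such that the following holds. Let $(\omega,\tau)$ be a random pair, defined on a probability space, which is almost surely quasi-free, and assume that there is a random $M_0\in(0,\infty)$ such that almost surely $|\omega(A)|\le M_0\|A\|$ for all $A\in\mathcal A_1$. Let $I\subset\mathbb R$ and suppose that for all $x,y\in\mathbb Z$ $$\max_{\#,\flat\in\{\pm\}}\mathbb E\Big[\sup_{s,t\in I}\big|\omega\big(a_x^\#(t)\,a_y^\flat(s)\big)\big|\Big]\le C\,e^{-\mu|x-y|}.$$ Then for every $n\ge1$ and all pairwise distinct $(x_1,\#_1),\dots,(x_{2n},\#_{2n})\in\mathbb Z\times\{\pm\}$ $$\mathbb E\Big[\sup_{t\in I^{2n}}\frac1{M_0}\Big|\mathrm{pf}\big(\omega(a_{x_j}^{\#_j}(t_j)\,a_{x_k}^{\#_k}(t_k))\big)_{1\le j<k\le 2n}\Big|\Big]\le C'\,e^{-\mu\, r(x)/3},$$ where $r(x)=\max_{1\le j\le n}|x_{2j}-x_{2j-1}|$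 if $x_1\le x_2\le\dots\le x_{2n}$, and otherwise $r(x)$ is computed from the increasing rearrangement of $x$. Here $\mathbb E$ denotes the outer expectation (the infimum of the expectations of measurable majorants), which is the usual expectation whenever the random variable in question is measurable. -/

import Mathlib

open MeasureTheory

noncomputable section

namespace CAR

open scoped ENNReal InnerProductSpace

/-- The single-particle Hilbert space `ℓ²(ℤ)`. -/
abbrev OneParticle : Type := lp (fun _ : ℤ => ℂ) 2

/-- The fermionic Fock space over `ℓ²(ℤ)` in the occupation number representation: the
orthonormal basis vector indexed by a finite set `S = {y₁ < ⋯ < yₙ}` of sites is the Slater state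
`δ_{y₁} ∧ ⋯ ∧ δ_{yₙ}`, and `ψ S` is the coefficient of `ψ` along it. -/
abbrev Fock : Type := lp (fun _ : Finset ℤ => ℂ) 2

/-- The bounded operator `(W ψ)(S) = k S * ψ (e S)` for a bijection `e` and weights `|k| ≤ 1`. -/
def weighted (e : Equiv.Perm (Finset ℤ)) (k : Finset ℤ → ℂ) (hk : ∀ S, ‖k S‖ ≤ 1) :
    Fock →L[ℂ] Fock :=
  have key : ∀ ψ : Fock, Summable fun S => ‖k S * ψ (e S)‖ ^ (2 : ℝ≥0∞).toReal := fun ψ => by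
    have h := (e.summable_iff).2 ((lp.memℓp ψ).summable (by norm_num))
    refine Summable.of_nonneg_of_le (fun S => by positivity) (fun S => ?_) h
    refine Real.rpow_le_rpow (norm_nonneg _) ?_ (by norm_num)
    rw [norm_mul]
    exact mul_le_of_le_one_left (norm_nonneg _) (hk S)
  LinearMap.mkContinuous
    { toFun := fun ψ => ⟨fun S => k S * ψ (e S), memℓp_gen (key ψ)⟩
      map_add' := fun ψ φ => by ext S; exact mul_add _ _ _
      map_smul' := fun z ψ => by ext S; simp [mul_left_comm] } 1 (fun ψ => by
    rw [one_mul]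
    refine lp.norm_le_of_tsum_le (by norm_num) (norm_nonneg _) ?_
    rw [lp.norm_rpow_eq_tsum (by norm_num)]
    rw [← e.tsum_eq (fun S => ‖ψ S‖ ^ (2 : ℝ≥0∞).toReal)]
    refine (key ψ).tsum_le_tsum (fun S => ?_)
      ((e.summable_iff).2 ((lp.memℓp ψ).summable (by norm_num)))
    refine Real.rpow_le_rpow (norm_nonneg _) ?_ (by norm_num)
    change ‖k S * ψ (e S)‖ ≤ _
    rw [norm_mul]
    exact mul_le_of_le_one_left (norm_nonneg _) (hk S))

theorem weighted_apply (e : Equiv.Perm (Finset ℤ)) (k : Finset ℤ → ℂ) (hk : ∀ S, ‖k S‖ ≤ 1)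
    (ψ : Fock) (S : Finset ℤ) : weighted e k hk ψ S = k S * ψ (e S) := rfl

/-- Changing the occupation of the site `x`. -/
def toggle (x : ℤ) : Equiv.Perm (Finset ℤ) where
  toFun S := symmDiff S {x}
  invFun S := symmDiff S {x}
  left_inv _ := symmDiff_symmDiff_cancel_right _ _
  right_inv _ := symmDiff_symmDiff_cancel_right _ _

/-- The fermionic sign `(-1)^{#{y ∈ S : y < x}}`. -/
def fsign (x : ℤ) (S : Finset ℤ) : ℂ := (-1) ^ (S.filter (· < x)).card

theorem norm_fsign (x : ℤ) (S : Finset ℤ) : ‖fsign x S‖ = 1 := by simp [fsign]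

/-- The annihilation operator `c(δ_x)`:
`(c(δ_x) ψ)(S) = 0` if `x ∈ S` and `(c(δ_x) ψ)(S) = (-1)^{#{y ∈ S : y < x}} ψ(S ∪ {x})` otherwise;
equivalently `c(δ_x)` removes a particle at `x` with the usual sign. -/
def annSite (x : ℤ) : Fock →L[ℂ] Fock :=
  weighted (toggle x) (fun S => if x ∈ S then 0 else fsign x S)
    (fun S => by split_ifs <;> simp [norm_fsign])

theorem annSite_apply (x : ℤ) (ψ : Fock) (S : Finset ℤ) :
    annSite x ψ S = if x ∈ S then 0 else fsign x S * ψ (insert x S) := by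
  by_cases h : x ∈ S
  · simp [annSite, weighted_apply, h]
  · have : toggle x S = insert x S := by
      ext y; by_cases hy : y = x <;> simp [toggle, Finset.mem_symmDiff, hy, h]
    simp [annSite, weighted_apply, h, this]

theorem toggle_toggle (x : ℤ) (S : Finset ℤ) : toggle x (toggle x S) = S :=
  symmDiff_symmDiff_cancel_right _ _

theorem toggle_comm (x y : ℤ) (S : Finset ℤ) : toggle x (toggle y S) = toggle y (toggle x S) :=
  symmDiff_right_comm _ _ _

theorem mem_toggle (x y : ℤ) (S : Finset ℤ) : x ∈ toggle y S ↔ (if x = y then x ∉ S else x ∈ S) := by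
  by_cases h : x = y <;> simp [toggle, Finset.mem_symmDiff, h]

theorem fsign_toggle (x y : ℤ) (S : Finset ℤ) :
    fsign x (toggle y S) = (if y < x then -1 else 1) * fsign x S := by
  by_cases hy : y < x
  · by_cases hS : y ∈ S
    · have h1 : (toggle y S).filter (· < x) = (S.filter (· < x)).erase y := by
        ext z; by_cases hz : z = y <;> simp [mem_toggle, hz, hS]
      have h2 : y ∈ S.filter (· < x) := by simp [hS, hy]
      have h3 := Finset.card_erase_add_one h2
      simp only [fsign, h1, hy, if_true]
      rw [← h3, pow_succ]; ring
    · have h1 : (toggle y S).filter (· < x) = insert y (S.filter (· < x)) := by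
        ext z; by_cases hz : z = y <;> simp [mem_toggle, hz, hS, hy]
      have h2 : y ∉ S.filter (· < x) := by simp [hS]
      simp only [fsign, h1, hy, if_true]
      rw [Finset.card_insert_of_notMem h2, pow_succ]; ring
  · have h1 : (toggle y S).filter (· < x) = S.filter (· < x) := by
      ext z; by_cases hz : z = y <;> simp [mem_toggle, hz, hy]
    simp [fsign, h1, hy]

theorem star_annSite_apply (x : ℤ) (ψ : Fock) (S : Finset ℤ) :
    (star (annSite x)) ψ S = if x ∈ S then fsign x S * ψ (toggle x S) else 0 := by
  have h : star (annSite x) = weighted (toggle x) (fun S => if x ∈ S then fsign x S else 0)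
      (fun S => by split_ifs <;> simp [norm_fsign]) := by
    rw [ContinuousLinearMap.star_eq_adjoint]
    symm
    rw [ContinuousLinearMap.eq_adjoint_iff]
    intro φ χ
    rw [lp.inner_eq_tsum, lp.inner_eq_tsum, ← (toggle x).tsum_eq]
    refine tsum_congr fun S => ?_
    rw [weighted_apply, annSite, weighted_apply, toggle_toggle]
    simp only [mem_toggle, fsign_toggle]
    by_cases hS : x ∈ S
    · simp [hS]
    · simp [hS, fsign]; ring
  rw [h, weighted_apply]
  split_ifs <;> simp

theorem annSite_car (x y : ℤ) :
    annSite x * star (annSite y) + star (annSite y) * annSite x = if x = y then 1 else 0 := by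
  ext ψ S
  have e1 : (annSite x * star (annSite y)) ψ S = _ :=
    weighted_apply _ _ (fun S => by split_ifs <;> simp [norm_fsign]) (star (annSite y) ψ) S
  have e2 : (star (annSite y) * annSite x) ψ S = _ := star_annSite_apply y (annSite x ψ) S
  have e3 : annSite x ψ (toggle y S) = _ := weighted_apply _ _
    (fun S => by split_ifs <;> simp [norm_fsign]) ψ (toggle y S)
  rw [e3] at e2
  rw [star_annSite_apply] at e1
  have e0 : ((annSite x * star (annSite y) + star (annSite y) * annSite x) ψ) S =
    (annSite x * star (annSite y)) ψ S + (star (annSite y) * annSite x) ψ S := rfl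
  rw [e0, e1, e2]
  simp only [mem_toggle, fsign_toggle]
  have hs : fsign x S * fsign x S = 1 := by simp [fsign, ← pow_add, ← two_mul]
  rcases eq_or_ne x y with rfl | hxy
  · by_cases hS : x ∈ S <;> simp [hS, toggle_toggle, ← mul_assoc, hs]
  · rw [toggle_comm y x]
    by_cases hx : x ∈ S <;> by_cases hy : y ∈ S <;> simp [hx, hy, hxy, hxy.symm]
    rcases lt_or_gt_of_ne hxy with h | h
    · simp [h, h.not_gt]; ring
    · simp [h, h.not_gt]; ring

theorem norm_sum_annSite_sq_le (t : Finset ℤ) (f : ℤ → ℂ) :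
    ‖∑ x ∈ t, star (f x) • annSite x‖ ^ 2 ≤ ∑ x ∈ t, ‖f x‖ ^ 2 := by
  set T := ∑ x ∈ t, star (f x) • annSite x with hT
  have hcar : T * star T + star T * T = ((∑ x ∈ t, ‖f x‖ ^ 2 : ℝ) : ℂ) • 1 := by
    have hstar : star T = ∑ y ∈ t, f y • star (annSite y) := by
      simp [hT, star_sum]
    rw [hstar, hT, Finset.sum_mul_sum, Finset.sum_mul_sum, Finset.sum_comm,
      ← Finset.sum_add_distrib]
    have : ∀ y ∈ t, (∑ x ∈ t, (star (f x) • annSite x) * (f y • star (annSite y)) +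
        ∑ x ∈ t, (f y • star (annSite y)) * (star (f x) • annSite x)) =
        ((‖f y‖ ^ 2 : ℝ) : ℂ) • (1 : Fock →L[ℂ] Fock) := by
      intro y hy
      rw [← Finset.sum_add_distrib]
      have : ∀ x ∈ t, (star (f x) • annSite x) * (f y • star (annSite y)) +
        (f y • star (annSite y)) * (star (f x) • annSite x) =
        if x = y then (star (f x) * f y) • (1 : Fock →L[ℂ] Fock) else 0 := by
        intro x _
        rw [smul_mul_smul_comm, smul_mul_smul_comm, mul_comm (f y), ← smul_add, annSite_car]
        split_ifs <;> simp
      rw [Finset.sum_congr rfl this, Finset.sum_ite_eq' t y, if_pos hy]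
      congr 1
      rw [Complex.ofReal_pow, ← Complex.conj_mul']
      rfl
    rw [Finset.sum_congr rfl this, ← Finset.sum_smul]
    simp
  have hpos : 0 ≤ ∑ x ∈ t, ‖f x‖ ^ 2 := Finset.sum_nonneg fun _ _ => by positivity
  have hb : ‖T‖ ≤ Real.sqrt (∑ x ∈ t, ‖f x‖ ^ 2) := by
    refine ContinuousLinearMap.opNorm_le_bound _ (Real.sqrt_nonneg _) fun ψ => ?_
    refine le_of_sq_le_sq ?_ (by positivity)
    rw [mul_pow, Real.sq_sqrt hpos]
    have h1 : ⟪ψ, (T * star T + star T * T) ψ⟫_ℂ = (‖star T ψ‖ ^ 2 + ‖T ψ‖ ^ 2 : ℝ) := by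
      have : (T * star T + star T * T) ψ = T (star T ψ) + star T (T ψ) := rfl
      rw [this, inner_add_right, ContinuousLinearMap.star_eq_adjoint,
        ContinuousLinearMap.adjoint_inner_right, ← ContinuousLinearMap.adjoint_inner_left,
        inner_self_eq_norm_sq_to_K, inner_self_eq_norm_sq_to_K]
      push_cast; rfl
    rw [hcar] at h1
    have h2 : ⟪ψ, (((∑ x ∈ t, ‖f x‖ ^ 2 : ℝ) : ℂ) • (1 : Fock →L[ℂ] Fock)) ψ⟫_ℂ =
        (((∑ x ∈ t, ‖f x‖ ^ 2) * ‖ψ‖ ^ 2 : ℝ) : ℂ) := by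
      rw [smul_apply, inner_smul_right, one_apply_eq_self,
        inner_self_eq_norm_sq_to_K]
      push_cast; rfl
    rw [h2] at h1
    have h3 := Complex.ofReal_injective h1
    rw [h3]
    nlinarith [sq_nonneg ‖star T ψ‖]
  calc ‖T‖ ^ 2 ≤ Real.sqrt (∑ x ∈ t, ‖f x‖ ^ 2) ^ 2 := by gcongr
    _ = _ := Real.sq_sqrt hpos

/-- The series defining `c(f)` converges in operator norm. -/
theorem summable_ann (f : OneParticle) : Summable fun x : ℤ => star (f x) • annSite x := by
  have hf : Summable fun x : ℤ => ‖f x‖ ^ 2 := by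
    have := (lp.memℓp f).summable (by norm_num)
    simpa using this
  rw [summable_iff_vanishing_norm]
  intro ε hε
  obtain ⟨s, hs⟩ := summable_iff_vanishing_norm.1 hf (ε ^ 2) (by positivity)
  refine ⟨s, fun t ht => ?_⟩
  have h1 := norm_sum_annSite_sq_le t f
  have h2 := (le_abs_self _).trans_lt (hs t ht)
  exact lt_of_pow_lt_pow_left₀ 2 hε.le (h1.trans_lt h2)

/-- The annihilation operator `c(f) = ∑ₓ conj (f x) c(δ_x)` for `f ∈ ℓ²(ℤ)` (antilinear in `f`;
the series converges in norm by `summable_ann`). -/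
def ann (f : OneParticle) : Fock →L[ℂ] Fock := ∑' x : ℤ, star (f x) • annSite x

theorem ann_single (x : ℤ) : ann (lp.single 2 x (1 : ℂ)) = annSite x := by
  rw [ann, tsum_eq_single x]
  · simp
  · intro y hy
    simp [hy]

/-- The CAR algebra `𝒜₁ = 𝒜(ℓ²(ℤ))`: the C*-algebra of operators on Fock space generated by the
identity and all `c(f)`, `c(f)*`, that is, the norm closure of the unital *-algebra they generate. -/
def carAlgebra : StarSubalgebra ℂ (Fock →L[ℂ] Fock) :=
  (StarAlgebra.adjoin ℂ (Set.range ann)).topologicalClosure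

/-- The type of elements of the CAR algebra, with the operator norm. -/
abbrev Alg : Type := carAlgebra

/-- The annihilation operator `c(f)` as an element of the CAR algebra. -/
def c (f : OneParticle) : Alg :=
  ⟨ann f, StarSubalgebra.le_topologicalClosure _ (StarAlgebra.subset_adjoin ℂ _ ⟨f, rfl⟩)⟩

/-- The canonical basis vector `δ_x` of `ℓ²(ℤ)`. -/
def delta (x : ℤ) : OneParticle := lp.single 2 x (1 : ℂ)

/-- The two Majorana flavours `+` and `-`. -/
inductive Flavor
  | plus
  | minus

/-- The Majorana fermions `a_x^+ = c*(δ_x) + c(δ_x)` and `a_x^- = i (c*(δ_x) - c(δ_x))`. -/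
def majorana (x : ℤ) : Flavor → Alg
  | .plus => star (c (delta x)) + c (delta x)
  | .minus => Complex.I • (star (c (delta x)) - c (delta x))

/-- The position `2j - 1` of a `2n`-tuple (for `j = 1, …, n` counted from `1`). -/
def oddPos {n : ℕ} (j : Fin n) : Fin (2 * n) := ⟨2 * j, by omega⟩

/-- The position `2j` of a `2n`-tuple (for `j = 1, …, n` counted from `1`). -/
def evenPos {n : ℕ} (j : Fin n) : Fin (2 * n) := ⟨2 * j + 1, by omega⟩

/-- The skew-symmetric matrix identified with the triangular array `(A j k)_{j < k}`; the values
of `A` on and below the diagonal are not used. -/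
def skew {m : ℕ} (A : Fin m → Fin m → ℂ) : Matrix (Fin m) (Fin m) ℂ :=
  Matrix.of fun j k => if j < k then A j k else if k < j then -A k j else 0

/-- The pfaffian `pf (A j k)_{j < k}` of a triangular array of size `2n`, i.e. of the corresponding
skew-symmetric matrix. -/
def pf {n : ℕ} (A : Fin (2 * n) → Fin (2 * n) → ℂ) : ℂ :=
  1 / (2 ^ n * (n.factorial : ℂ)) * ∑ π : Equiv.Perm (Fin (2 * n)),
    ((Equiv.Perm.sign π : ℤ) : ℂ) * ∏ j : Fin n, skew A (π (oddPos j)) (π (evenPos j))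

/-- The time-evolved Majorana fermion `a_x^#(t) = τ_t(a_x^#)`. -/
def evolved (τ : ℝ → Alg ≃⋆ₐ[ℂ] Alg) (x : ℤ) (σ : Flavor) (t : ℝ) : Alg := τ t (majorana x σ)

/-- The pfaffian of the two-point functions
`pf (ω(a_{x_j}^{σ_j}(t_j) a_{x_k}^{σ_k}(t_k)))_{1 ≤ j < k ≤ 2n}`. -/
def corrPf (ω : Alg →ₗ[ℂ] ℂ) (τ : ℝ → Alg ≃⋆ₐ[ℂ] Alg) {n : ℕ} (x : Fin (2 * n) → ℤ)
    (σ : Fin (2 * n) → Flavor) (t : Fin (2 * n) → ℝ) : ℂ :=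
  pf fun j k => ω (evolved τ (x j) (σ j) (t j) * evolved τ (x k) (σ k) (t k))

/-- A linear functional `ω` and a family `τ = (τ_t)` of (*-)automorphisms of the CAR algebra form a
quasi-free pair if all time-dependent multipoint correlation functions of the Majorana fermions
(of any even number `2n > 0` of them, at arbitrary sites, flavours and times)
satisfy the Wick relation. -/
def IsQuasiFreePair (ω : Alg →ₗ[ℂ] ℂ) (τ : ℝ → Alg ≃⋆ₐ[ℂ] Alg) : Prop :=
  ∀ n : ℕ, 1 ≤ n → ∀ (x : Fin (2 * n) → ℤ) (σ : Fin (2 * n) → Flavor) (t : Fin (2 * n) → ℝ),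
    ω (List.ofFn fun j => evolved τ (x j) (σ j) (t j)).prod = corrPf ω τ x σ t

/-- `(x_j, σ_j)` is a Majorana configuration: the tuples are pairwise distinct. -/
def IsMajoranaConfig {m : ℕ} (x : Fin m → ℤ) (σ : Fin m → Flavor) : Prop :=
  Function.Injective fun j => (x j, σ j)

/-- `r(x) = max_j |x_{2j} - x_{2j-1}|` for ordered points `x₁ ≤ ⋯ ≤ x_{2n}`; points which are not
ordered are first put into increasing order (`x ∘ Tuple.sort x`, which is `x` if `x` is ordered). -/
def r {n : ℕ} (x : Fin (2 * n) → ℤ) : ℕ :=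
  Finset.univ.sup fun j : Fin n =>
    (x (Tuple.sort x (evenPos j)) - x (Tuple.sort x (oddPos j))).natAbs

theorem r_of_monotone {n : ℕ} {x : Fin (2 * n) → ℤ} (hx : Monotone x) :
    r x = Finset.univ.sup fun j : Fin n => (x (evenPos j) - x (oddPos j)).natAbs := by
  rw [r, Tuple.sort_eq_refl_iff_monotone.2 hx]; rfl

/-- The expectation `𝔼[f]` of a `[0, ∞]`-valued function. Suprema over uncountable index sets need
not be measurable, so it is defined for all `f`, as the outer expectation; on measurable `f` it is
the usual expectation (`expect_eq_lintegral`). -/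
def expect {Ω : Type*} [MeasurableSpace Ω] (P : Measure Ω) (f : Ω → ℝ≥0∞) : ℝ≥0∞ :=
  ⨅ (g : Ω → ℝ≥0∞) (_ : Measurable g) (_ : ∀ p, f p ≤ g p), ∫⁻ p, g p ∂P

theorem expect_eq_lintegral {Ω : Type*} [MeasurableSpace Ω] (P : Measure Ω) {f : Ω → ℝ≥0∞}
    (hf : AEMeasurable f P) : expect P f = ∫⁻ p, f p ∂P := by
  refine le_antisymm ?_ (le_iInf fun g => le_iInf fun _ => le_iInf fun h => lintegral_mono h)
  obtain ⟨N, hN, hNm, hN0⟩ := exists_measurable_superset_of_null hf.ae_eq_mk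
  classical
  have hm : Measurable (N.piecewise (fun _ => ∞) (hf.mk f)) :=
    Measurable.piecewise hNm measurable_const hf.measurable_mk
  have hle : ∀ p, f p ≤ N.piecewise (fun _ => ∞) (hf.mk f) p := fun p => by
    by_cases hp : p ∈ N
    · simp [hp]
    · have : f p = hf.mk f p := by by_contra h; exact hp (hN h)
      simp [hp, this]
  refine (iInf₂_le_of_le (N.piecewise (fun _ => ∞) (hf.mk f)) hm (iInf_le _ hle)).trans
    (le_of_eq (lintegral_congr_ae ?_))
  have : ∀ᵐ p ∂P, p ∉ N := measure_eq_zero_iff_ae_notMem.1 hN0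
  filter_upwards [this, hf.ae_eq_mk] with p hp h
  simp [hp, h]

end CAR

end

/-! Fix the disorder and the times, and let M be the skew matrix of two-point functions. By the Wick
relation every nonempty sub-pfaffian of M is, up to sign, ω of a product of self-adjoint
involutions, hence bounded by M₀. The pfaffian is affine in each pair of entries, with a
sub-pfaffian as coefficient. Deleting the couplings between a set J and its complement one pair at a
time therefore costs at most M₀ (∏ (1 + |M_z|) - 1) over the deleted pairs z
(`norm_matrixPf_zeroOn_sub_le`), provided that M₀ ≥ 1, since the empty pfaffian is 1. If J has odd
size, the decoupled pfaffian is zero. With X the sum of the |M_z|, this gives |pf M| ≤ 2 M₀ X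
(`norm_matrixPf_le_cross_sum`): by exponentiation for X ≤ 1, and trivially for X ≥ 1.

This bound is linear in the two-point functions and contains no factor depending on n, so suprema
and expectations pass through it. Cutting at the gap that realises r(x) makes J odd, and every cross
distance is r(x) plus the distances of the two sites to the gap. Summing the decay hypothesis gives
two geometric-type factors times exp(-μ r(x)) (`exists_odd_splitting`).

If M₀ < 1, then |ω(1)| < 1 and the Wick relation forces all two-point functions to vanish
(`norm_twoPoint_eq`). -/

noncomputable section

namespace CAR

open scoped ENNReal InnerProductSpace

/-! ### Pfaffians: permutations and the change of one pair of entries -/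

/-- The pfaffian sum of an arbitrary square matrix of even size. -/
def matrixPf {n : ℕ} (M : Matrix (Fin (2 * n)) (Fin (2 * n)) ℂ) : ℂ :=
  1 / (2 ^ n * (n.factorial : ℂ)) * ∑ π : Equiv.Perm (Fin (2 * n)),
    ((Equiv.Perm.sign π : ℤ) : ℂ) * ∏ j : Fin n, M (π (oddPos j)) (π (evenPos j))

theorem pf_eq_matrixPf {n : ℕ} (A : Fin (2 * n) → Fin (2 * n) → ℂ) :
    pf A = matrixPf (skew A) := rfl

theorem matrixPf_submatrix_perm {n : ℕ} (M : Matrix (Fin (2 * n)) (Fin (2 * n)) ℂ)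
    (ρ : Equiv.Perm (Fin (2 * n))) :
    matrixPf (M.submatrix ρ ρ) = ((Equiv.Perm.sign ρ : ℤ) : ℂ) * matrixPf M := by
  unfold matrixPf
  rw [mul_left_comm]
  congr 1
  rw [Finset.mul_sum, ← Equiv.sum_comp (Equiv.mulLeft ρ) (fun π => _ * (_ * _))]
  refine Finset.sum_congr rfl fun π _ => ?_
  have h : ((Equiv.Perm.sign ρ : ℤ) : ℂ) * ((Equiv.Perm.sign ρ : ℤ) : ℂ) = 1 := by
    rw [← Int.cast_mul, ← Units.val_mul, Int.units_mul_self]; simp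
  simp only [Equiv.coe_mulLeft, Equiv.Perm.sign_mul, Units.val_mul, Int.cast_mul,
    Equiv.Perm.mul_apply, Matrix.submatrix_apply]
  rw [← mul_assoc, ← mul_assoc, h, one_mul]

theorem oddPos_injective {n : ℕ} : Function.Injective (oddPos (n := n)) := fun i j h => by
  simpa [oddPos, Fin.ext_iff] using h

theorem evenPos_injective {n : ℕ} : Function.Injective (evenPos (n := n)) := fun i j h => by
  simpa [evenPos, Fin.ext_iff] using h

theorem oddPos_ne_evenPos {n : ℕ} (i j : Fin n) : oddPos i ≠ evenPos j := by
  simp only [oddPos, evenPos, ne_eq, Fin.ext_iff]; omega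

/-- The antisymmetric elementary matrix with entries `±d` at `(i, l)` and `(l, i)`. -/
def elemSkew {ι : Type*} [DecidableEq ι] (i l : ι) (d : ℂ) : Matrix ι ι ℂ :=
  Matrix.of fun p q => if p = i ∧ q = l then d else if p = l ∧ q = i then -d else 0

theorem prod_add_of_subsingleton {ι : Type*} [Fintype ι] [DecidableEq ι] (u v : ι → ℂ)
    (h : ∀ j k, v j ≠ 0 → v k ≠ 0 → j = k) :
    ∏ j, (u j + v j) = ∏ j, u j + ∑ j, v j * ∏ k ∈ Finset.univ.erase j, u k := by
  by_cases h0 : ∃ j, v j ≠ 0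
  · obtain ⟨j, hj⟩ := h0
    have hk : ∀ k, k ≠ j → v k = 0 := fun k hk => by
      by_contra h1; exact hk (h k j h1 hj)
    rw [← Finset.mul_prod_erase _ _ (Finset.mem_univ j), Finset.sum_eq_single j
      (fun k _ h1 => by rw [hk k h1, zero_mul]) (by simp),
      ← Finset.mul_prod_erase Finset.univ u (Finset.mem_univ j), add_mul]
    congr 2
    all_goals exact Finset.prod_congr rfl fun k h1 => by rw [hk k (Finset.ne_of_mem_erase h1), add_zero]
  · push Not at h0
    simp [h0]

/-- The n factors of a pfaffian term play the same role: exchanging two whole pairs is an even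
permutation. Hence it suffices to compute with the distinguished factor in the last place. -/
theorem sum_perm_pair_eq {n : ℕ} (D M : Matrix (Fin (2 * n)) (Fin (2 * n)) ℂ) (i j : Fin n) :
    ∑ π : Equiv.Perm (Fin (2 * n)), ((Equiv.Perm.sign π : ℤ) : ℂ) *
      (D (π (oddPos i)) (π (evenPos i)) *
        ∏ k ∈ Finset.univ.erase i, M (π (oddPos k)) (π (evenPos k))) =
    ∑ π : Equiv.Perm (Fin (2 * n)), ((Equiv.Perm.sign π : ℤ) : ℂ) *
      (D (π (oddPos j)) (π (evenPos j)) *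
        ∏ k ∈ Finset.univ.erase j, M (π (oddPos k)) (π (evenPos k))) := by
  rcases eq_or_ne i j with rfl | hij
  · rfl
  -- Two disjoint transpositions, so the sign is unchanged.
  set ρ : Equiv.Perm (Fin (2 * n)) :=
    Equiv.swap (oddPos i) (oddPos j) * Equiv.swap (evenPos i) (evenPos j) with hρ
  have ho : ∀ k, ρ (oddPos k) = oddPos (Equiv.swap i j k) := fun k => by
    rw [hρ, Equiv.Perm.mul_apply, Equiv.swap_apply_of_ne_of_ne (oddPos_ne_evenPos _ _)
      (oddPos_ne_evenPos _ _), oddPos_injective.swap_apply]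
  have he : ∀ k, ρ (evenPos k) = evenPos (Equiv.swap i j k) := fun k => by
    rw [hρ, Equiv.Perm.mul_apply, evenPos_injective.swap_apply, Equiv.swap_apply_of_ne_of_ne
      (oddPos_ne_evenPos _ _).symm (oddPos_ne_evenPos _ _).symm]
  have hs : Equiv.Perm.sign ρ = 1 := by
    rw [hρ, Equiv.Perm.sign_mul, Equiv.Perm.sign_swap (oddPos_injective.ne hij),
      Equiv.Perm.sign_swap (evenPos_injective.ne hij)]; simp
  rw [← Equiv.sum_comp (Equiv.mulRight ρ)]
  refine Finset.sum_congr rfl fun π _ => ?_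
  simp only [Equiv.coe_mulRight, Equiv.Perm.sign_mul, hs, mul_one, Equiv.Perm.mul_apply, ho, he,
    Equiv.swap_apply_left]
  congr 2
  refine Finset.prod_equiv (Equiv.swap i j) (fun k => ?_) (fun k _ => rfl)
  simp only [Finset.mem_erase, Finset.mem_univ, and_true, ne_eq]
  rw [not_iff_not, ← Equiv.eq_symm_apply]
  simp

/-- The inclusion of the first `2 n` indices. -/
def firstEmb (n : ℕ) : Fin (2 * n) → Fin (2 * (n + 1)) := Fin.castLE (by omega)

theorem firstEmb_injective (n : ℕ) : Function.Injective (firstEmb n) := Fin.castLE_injective _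

/-- The first `2 n` indices as a subtype. -/
def firstEquiv (n : ℕ) : Fin (2 * n) ≃ {i : Fin (2 * (n + 1)) // (i : ℕ) < 2 * n} where
  toFun i := ⟨firstEmb n i, i.2⟩
  invFun i := ⟨i.1, i.2⟩
  left_inv _ := rfl
  right_inv _ := rfl

theorem eq_last_of_not_lt {n : ℕ} (i : Fin (2 * (n + 1))) (h : ¬ (i : ℕ) < 2 * n) :
    i = oddPos (Fin.last n) ∨ i = evenPos (Fin.last n) := by
  simp only [oddPos, evenPos, Fin.ext_iff, Fin.val_last]; omega

/-- Permutations fixing the last two indices are exactly the extensions by the identity of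
permutations of the first 2n indices, with the same sign. -/
theorem sum_perm_fix_last {n : ℕ} (M : Matrix (Fin (2 * (n + 1))) (Fin (2 * (n + 1))) ℂ) :
    (∑ π : Equiv.Perm (Fin (2 * (n + 1))), if π (oddPos (Fin.last n)) = oddPos (Fin.last n) ∧
        π (evenPos (Fin.last n)) = evenPos (Fin.last n) then ((Equiv.Perm.sign π : ℤ) : ℂ) *
        ∏ k ∈ Finset.univ.erase (Fin.last n), M (π (oddPos k)) (π (evenPos k)) else 0) =
    ∑ π : Equiv.Perm (Fin (2 * n)), ((Equiv.Perm.sign π : ℤ) : ℂ) *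
        ∏ k : Fin n, M (firstEmb n (π (oddPos k))) (firstEmb n (π (evenPos k))) := by
  rw [← Finset.sum_filter]
  symm
  refine Finset.sum_bij (fun π _ => π.extendDomain (firstEquiv n)) ?_ ?_ ?_ ?_
  · intro π _
    simp only [Finset.mem_filter, Finset.mem_univ, true_and]
    constructor <;> refine Equiv.Perm.extendDomain_apply_not_subtype _ _ ?_ <;>
      simp [oddPos, evenPos]
  · intro π _ π' _ h
    exact Equiv.Perm.extendDomainHom_injective (firstEquiv n) h
  · intro π hπ
    simp only [Finset.mem_filter, Finset.mem_univ, true_and] at hπ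
    have hfix : ∀ i : Fin (2 * (n + 1)), ¬ (i : ℕ) < 2 * n → π i = i := fun i hi => by
      rcases eq_last_of_not_lt i hi with rfl | rfl
      exacts [hπ.1, hπ.2]
    have hmem : ∀ i : Fin (2 * (n + 1)), (π i : ℕ) < 2 * n ↔ (i : ℕ) < 2 * n := fun i => by
      constructor
      · intro h; by_contra h1; rw [hfix i h1] at h; exact h1 h
      · intro h; by_contra h1
        have := π.injective (hfix _ h1)
        rw [this] at h1; exact h1 h
    refine ⟨(firstEquiv n).symm.permCongr (π.subtypePerm hmem), Finset.mem_univ _, ?_⟩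
    refine Equiv.ext fun i => ?_
    by_cases hi : (i : ℕ) < 2 * n
    · rw [Equiv.Perm.extendDomain_apply_subtype (p := fun i : Fin (2 * (n + 1)) => (i : ℕ) < 2 * n)
        _ _ hi]
      simp
    · rw [Equiv.Perm.extendDomain_apply_not_subtype
        (p := fun i : Fin (2 * (n + 1)) => (i : ℕ) < 2 * n) _ _ hi, hfix i hi]
  · intro π _
    rw [Equiv.Perm.sign_extendDomain]
    congr 1
    refine Finset.prod_bij (fun k _ => k.castSucc) ?_ ?_ ?_ ?_
    · intro k _; simp [Fin.ext_iff]; omega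
    · intro k _ k' _ h; exact Fin.castSucc_injective _ h
    · intro k hk
      simp only [Finset.mem_erase, Finset.mem_univ, and_true] at hk
      exact ⟨k.castPred hk, Finset.mem_univ _, Fin.castSucc_castPred _ _⟩
    · intro k _
      have ho : oddPos k.castSucc = ((firstEquiv n (oddPos k) : _) : Fin (2 * (n + 1))) := rfl
      have he : evenPos k.castSucc = ((firstEquiv n (evenPos k) : _) : Fin (2 * (n + 1))) := rfl
      rw [ho, he, Equiv.Perm.extendDomain_apply_image, Equiv.Perm.extendDomain_apply_image]
      rfl

theorem sum_perm_last_pair {n : ℕ} (M : Matrix (Fin (2 * (n + 1))) (Fin (2 * (n + 1))) ℂ)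
    (d : ℂ) :
    ∑ π : Equiv.Perm (Fin (2 * (n + 1))), ((Equiv.Perm.sign π : ℤ) : ℂ) *
      (elemSkew (oddPos (Fin.last n)) (evenPos (Fin.last n)) d
        (π (oddPos (Fin.last n))) (π (evenPos (Fin.last n))) *
        ∏ k ∈ Finset.univ.erase (Fin.last n), M (π (oddPos k)) (π (evenPos k))) =
    2 * d * ∑ π : Equiv.Perm (Fin (2 * n)), ((Equiv.Perm.sign π : ℤ) : ℂ) *
        ∏ k : Fin n, M (firstEmb n (π (oddPos k))) (firstEmb n (π (evenPos k))) := by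
  set a : Fin (2 * (n + 1)) := oddPos (Fin.last n) with ha
  set b : Fin (2 * (n + 1)) := evenPos (Fin.last n) with hb
  have hab : a ≠ b := oddPos_ne_evenPos _ _
  set G : Equiv.Perm (Fin (2 * (n + 1))) → ℂ := fun π => if π a = a ∧ π b = b then
    ((Equiv.Perm.sign π : ℤ) : ℂ) *
        ∏ k ∈ Finset.univ.erase (Fin.last n), M (π (oddPos k)) (π (evenPos k)) else 0 with hG
  -- Only permutations that fix or exchange a and b contribute. For the latter, the sign of the swap
  -- cancels the minus sign in `elemSkew`, so both classes give the same sum.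
  have hterm : ∀ π : Equiv.Perm (Fin (2 * (n + 1))), ((Equiv.Perm.sign π : ℤ) : ℂ) *
      (elemSkew a b d (π a) (π b) *
        ∏ k ∈ Finset.univ.erase (Fin.last n), M (π (oddPos k)) (π (evenPos k))) =
      d * G π + d * G (π * Equiv.swap a b) := by
    intro π
    have h2 : ∏ k ∈ Finset.univ.erase (Fin.last n),
        M ((π * Equiv.swap a b) (oddPos k)) ((π * Equiv.swap a b) (evenPos k)) =
        ∏ k ∈ Finset.univ.erase (Fin.last n), M (π (oddPos k)) (π (evenPos k)) := by
      refine Finset.prod_congr rfl fun k hk => ?_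
      have hk := Finset.ne_of_mem_erase hk
      rw [Equiv.Perm.mul_apply, Equiv.Perm.mul_apply,
        Equiv.swap_apply_of_ne_of_ne (oddPos_injective.ne hk) (oddPos_ne_evenPos _ _),
        Equiv.swap_apply_of_ne_of_ne (oddPos_ne_evenPos _ _).symm (evenPos_injective.ne hk)]
    simp only [hG]
    rw [h2, Equiv.Perm.sign_mul, Equiv.Perm.sign_swap hab]
    simp only [Equiv.Perm.mul_apply, Equiv.swap_apply_left, Equiv.swap_apply_right, elemSkew,
      Matrix.of_apply]
    by_cases h3 : π a = a ∧ π b = b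
    · have h4 : ¬ (π b = a ∧ π a = b) := fun h => hab (h3.1.symm.trans h.2)
      simp [h3, hab.symm, mul_left_comm]
    · by_cases h4 : π b = a ∧ π a = b
      · simp [h4, hab, hab.symm, mul_left_comm]
      · have h5 : ¬ (π a = b ∧ π b = a) := fun h => h4 ⟨h.2, h.1⟩
        simp [h3, h4, h5]
  rw [Finset.sum_congr rfl fun π _ => hterm π, Finset.sum_add_distrib, ← Finset.mul_sum,
    ← Finset.mul_sum, show ∑ π, G (π * Equiv.swap a b) = ∑ π, G π from
      Equiv.sum_comp (Equiv.mulRight (Equiv.swap a b)) G, hG, sum_perm_fix_last]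
  ring

theorem matrixPf_add_elemSkew_last {n : ℕ}
    (M : Matrix (Fin (2 * (n + 1))) (Fin (2 * (n + 1))) ℂ) (d : ℂ) :
    matrixPf (M + elemSkew (oddPos (Fin.last n)) (evenPos (Fin.last n)) d) =
      matrixPf M + d * matrixPf (M.submatrix (firstEmb n) (firstEmb n)) := by
  set a : Fin (2 * (n + 1)) := oddPos (Fin.last n) with ha
  set b : Fin (2 * (n + 1)) := evenPos (Fin.last n) with hb
  have hexp : ∀ π : Equiv.Perm (Fin (2 * (n + 1))),
      ∏ j, (M + elemSkew a b d) (π (oddPos j)) (π (evenPos j)) =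
      ∏ j, M (π (oddPos j)) (π (evenPos j)) + ∑ j, elemSkew a b d (π (oddPos j)) (π (evenPos j)) *
        ∏ k ∈ Finset.univ.erase j, M (π (oddPos k)) (π (evenPos k)) := by
    intro π
    refine prod_add_of_subsingleton (fun j => M (π (oddPos j)) (π (evenPos j)))
      (fun j => elemSkew a b d (π (oddPos j)) (π (evenPos j))) fun j k hj hk => ?_
    -- A factor affected by the perturbation must use the index a, which occurs in only one pair.
    have key : ∀ j, elemSkew a b d (π (oddPos j)) (π (evenPos j)) ≠ 0 →
        π (oddPos j) = a ∨ π (evenPos j) = a := by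
      intro j hj
      by_contra h
      push Not at h
      simp [elemSkew, h.1, h.2] at hj
    rcases key j hj with h1 | h1 <;> rcases key k hk with h2 | h2
    · exact oddPos_injective (π.injective (h1.trans h2.symm))
    · exact absurd (π.injective (h1.trans h2.symm)) (oddPos_ne_evenPos _ _)
    · exact absurd (π.injective (h2.trans h1.symm)) (oddPos_ne_evenPos _ _)
    · exact evenPos_injective (π.injective (h1.trans h2.symm))
  -- The n + 1 places for the perturbed pair and its two orientations give the factor 2 (n + 1),
  -- which turns the normalisation of size n + 1 into that of size n.
  have hsum : ∑ π : Equiv.Perm (Fin (2 * (n + 1))), ((Equiv.Perm.sign π : ℤ) : ℂ) *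
      ∑ j, elemSkew a b d (π (oddPos j)) (π (evenPos j)) *
        ∏ k ∈ Finset.univ.erase j, M (π (oddPos k)) (π (evenPos k)) =
      (n + 1) * (2 * d * ∑ π : Equiv.Perm (Fin (2 * n)), ((Equiv.Perm.sign π : ℤ) : ℂ) *
        ∏ k : Fin n, M (firstEmb n (π (oddPos k))) (firstEmb n (π (evenPos k)))) := by
    simp_rw [Finset.mul_sum (s := (Finset.univ : Finset (Fin (n + 1))))]
    rw [Finset.sum_comm, Finset.sum_congr rfl
      fun j _ => sum_perm_pair_eq (elemSkew a b d) M j (Fin.last n), sum_perm_last_pair]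
    simp
  unfold matrixPf
  simp_rw [hexp, mul_add, Finset.sum_add_distrib]
  rw [hsum, Nat.factorial_succ]
  simp only [Matrix.submatrix_apply]
  have : (n.factorial : ℂ) ≠ 0 := by exact_mod_cast n.factorial_ne_zero
  have : (n : ℂ) + 1 ≠ 0 := by exact_mod_cast n.succ_ne_zero
  push_cast
  field_simp
  ring

/-- Changing one pair of entries changes the pfaffian by a multiple of a sub-pfaffian. -/
theorem exists_matrixPf_add_elemSkew {n : ℕ} {i l : Fin (2 * (n + 1))} (hil : i ≠ l) :
    ∃ (g : Fin (2 * n) → Fin (2 * (n + 1))) (ε : ℂ), Function.Injective g ∧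
      (∀ j, g j ≠ i ∧ g j ≠ l) ∧ ‖ε‖ = 1 ∧
      ∀ (M : Matrix (Fin (2 * (n + 1))) (Fin (2 * (n + 1))) ℂ) (d : ℂ),
        matrixPf (M + elemSkew i l d) = matrixPf M + ε * d * matrixPf (M.submatrix g g) := by
  set a : Fin (2 * (n + 1)) := oddPos (Fin.last n) with ha
  set b : Fin (2 * (n + 1)) := evenPos (Fin.last n) with hb
  have hab : a ≠ b := oddPos_ne_evenPos _ _
  -- Relabelling by ρ reduces to the last pair; the sign of ρ becomes ε.
  obtain ⟨ρ, hρa, hρb⟩ : ∃ ρ : Equiv.Perm (Fin (2 * (n + 1))), ρ a = i ∧ ρ b = l := by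
    refine ⟨Equiv.swap (Equiv.swap a i b) l * Equiv.swap a i, ?_, ?_⟩
    · rw [Equiv.Perm.mul_apply, Equiv.swap_apply_left, Equiv.swap_apply_of_ne_of_ne _ hil]
      intro h
      have : Equiv.swap a i a = Equiv.swap a i b := by rw [Equiv.swap_apply_left]; exact h
      exact hab ((Equiv.swap a i).injective this)
    · rw [Equiv.Perm.mul_apply, Equiv.swap_apply_left]
  have hs : ((Equiv.Perm.sign ρ : ℤ) : ℂ) * ((Equiv.Perm.sign ρ : ℤ) : ℂ) = 1 := by
    rw [← Int.cast_mul, ← Units.val_mul, Int.units_mul_self]; simp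
  refine ⟨ρ ∘ firstEmb n, ((Equiv.Perm.sign ρ : ℤ) : ℂ), ρ.injective.comp (firstEmb_injective n),
    fun j => ⟨?_, ?_⟩, ?_, fun M d => ?_⟩
  · rw [← hρa]
    refine fun h => absurd (ρ.injective h) ?_
    simp only [firstEmb, ha, oddPos, Fin.ext_iff, Fin.val_castLE, Fin.val_last]; omega
  · rw [← hρb]
    refine fun h => absurd (ρ.injective h) ?_
    simp only [firstEmb, hb, evenPos, Fin.ext_iff, Fin.val_castLE, Fin.val_last]; omega
  · rcases Int.units_eq_one_or (Equiv.Perm.sign ρ) with h | h <;> simp [h]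
  · have h1 := matrixPf_submatrix_perm (M + elemSkew i l d) ρ
    have h2 := matrixPf_submatrix_perm M ρ
    have h3 : (M + elemSkew i l d).submatrix ρ ρ = M.submatrix ρ ρ + elemSkew a b d := by
      ext p q
      simp only [Matrix.submatrix_apply, Matrix.add_apply, elemSkew, Matrix.of_apply]
      rw [← hρa, ← hρb]
      simp only [ρ.injective.eq_iff]
    rw [h3, matrixPf_add_elemSkew_last, h2, Matrix.submatrix_submatrix] at h1
    set s := ((Equiv.Perm.sign ρ : ℤ) : ℂ)
    have h4 := congrArg (fun z => s * z) h1
    simp only [mul_add, ← mul_assoc, hs, one_mul] at h4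
    exact h4.symm

/-! ### Decoupling two blocks of a skew matrix -/

/-- The matrix `M` with the entries at the pairs in `Z` and at their transposes set to zero. -/
def zeroOn {ι : Type*} [DecidableEq ι] (Z : Finset (ι × ι)) (M : Matrix ι ι ℂ) : Matrix ι ι ℂ :=
  Matrix.of fun p q => if (p, q) ∈ Z ∨ (q, p) ∈ Z then 0 else M p q

theorem zeroOn_insert {ι : Type*} [DecidableEq ι] {Z : Finset (ι × ι)} {M : Matrix ι ι ℂ}
    (hM : ∀ p q, M p q = -M q p) {i l : ι} (hil : i ≠ l) (h1 : (i, l) ∉ Z) (h2 : (l, i) ∉ Z) :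
    zeroOn (insert (i, l) Z) M = zeroOn Z M + elemSkew i l (-M i l) := by
  ext p q
  simp only [zeroOn, elemSkew, Matrix.of_apply, Matrix.add_apply, Finset.mem_insert, Prod.mk.injEq]
  by_cases ha : p = i ∧ q = l
  · obtain ⟨rfl, rfl⟩ := ha
    simp [h1, h2]
  · by_cases hb : p = l ∧ q = i
    · obtain ⟨rfl, rfl⟩ := hb
      have := hM p q
      simp [h1, h2, hil.symm, this]
    · have hb' : ¬ (q = i ∧ p = l) := fun h => hb ⟨h.2, h.1⟩
      simp [ha, hb, hb']

theorem elemSkew_submatrix {ι κ : Type*} [DecidableEq ι] [DecidableEq κ] {f : κ → ι}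
    (hf : Function.Injective f) (p q : κ) (d : ℂ) :
    (elemSkew (f p) (f q) d).submatrix f f = elemSkew p q d := by
  ext a b
  simp [elemSkew, hf.eq_iff]

theorem elemSkew_submatrix_eq_zero {ι κ : Type*} [DecidableEq ι] {f : κ → ι} {i l : ι}
    (h : ¬ ∃ p q, f p = i ∧ f q = l) (d : ℂ) : (elemSkew i l d).submatrix f f = 0 := by
  ext a b
  have h1 : ¬ (f a = i ∧ f b = l) := fun h1 => h ⟨a, b, h1⟩
  have h2 : ¬ (f a = l ∧ f b = i) := fun h1 => h ⟨b, a, h1.2, h1.1⟩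
  simp [elemSkew, h1, h2]

/-- If all sub-pfaffians of a skew matrix are bounded by `K`, setting entries to zero changes them
by a controlled amount. -/
theorem norm_matrixPf_zeroOn_sub_le {ι : Type*} [DecidableEq ι] {M : Matrix ι ι ℂ}
    (hM : ∀ p q, M p q = -M q p) {K : ℝ}
    (hK : ∀ (m : ℕ) (f : Fin (2 * m) → ι), Function.Injective f →
      ‖matrixPf (M.submatrix f f)‖ ≤ K) (Z : Finset (ι × ι))
    (hZ : ∀ p q, (p, q) ∈ Z → p ≠ q ∧ (q, p) ∉ Z) {m : ℕ} {f : Fin (2 * m) → ι}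
    (hf : Function.Injective f) :
    ‖matrixPf ((zeroOn Z M).submatrix f f) - matrixPf (M.submatrix f f)‖ ≤
      K * (∏ z ∈ Z, (1 + ‖M z.1 z.2‖) - 1) := by
  have hK0 : 0 ≤ K := (norm_nonneg _).trans (hK m f hf)
  induction Z using Finset.induction_on generalizing m f with
  | empty =>
    have : zeroOn ∅ M = M := by ext; simp [zeroOn]
    simp [this]
  | insert z Z hz ih =>
    obtain ⟨i, l⟩ := z
    have hil := hZ i l (Finset.mem_insert_self _ _)
    have hZ' : ∀ p q, (p, q) ∈ Z → p ≠ q ∧ (q, p) ∉ Z := fun p q h =>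
      ⟨(hZ p q (Finset.mem_insert_of_mem h)).1, fun h' =>
        (hZ p q (Finset.mem_insert_of_mem h)).2 (Finset.mem_insert_of_mem h')⟩
    replace ih := fun (m : ℕ) (f : Fin (2 * m) → ι) (hf : Function.Injective f) => ih hZ' hf
    set Q := ∏ z ∈ Z, (1 + ‖M z.1 z.2‖) with hQ
    have hQ1 : 1 ≤ Q := by
      rw [hQ, ← Finset.prod_const_one (s := Z)]
      exact Finset.prod_le_prod (fun _ _ => zero_le_one) fun z _ => by simp
    rw [Finset.prod_insert hz, zeroOn_insert hM hil.1 hz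
      (fun h => hil.2 (Finset.mem_insert_of_mem h)), Matrix.submatrix_add]
    change ‖matrixPf ((zeroOn Z M).submatrix f f + (elemSkew i l _).submatrix f f) - _‖ ≤ _
    have hle : K * (Q - 1) ≤ K * ((1 + ‖M i l‖) * Q - 1) := by
      gcongr
      nlinarith [norm_nonneg (M i l)]
    -- If f misses i or l, deleting this pair does not affect the submatrix.
    by_cases h : ∃ p q, f p = i ∧ f q = l
    · obtain ⟨p, q, rfl, rfl⟩ := h
      rw [elemSkew_submatrix hf]
      obtain ⟨m, rfl⟩ : ∃ m', m = m' + 1 := by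
        rcases m with _ | m
        · exact p.elim0
        · exact ⟨m, rfl⟩
      obtain ⟨g, ε, hg, -, hε, hpf⟩ := exists_matrixPf_add_elemSkew (ne_of_apply_ne f hil.1)
      rw [hpf, Matrix.submatrix_submatrix]
      have b1 := ih _ f hf
      -- The coefficient is a sub-pfaffian of the partly decoupled matrix, to which `hK` does not
      -- apply directly. The induction hypothesis for f ∘ g bounds it by K + K (Q - 1), which is why
      -- the induction runs over all f at once.
      have b2 : ‖matrixPf ((zeroOn Z M).submatrix (f ∘ g) (f ∘ g))‖ ≤ K * Q := by
        have := norm_le_norm_sub_add (matrixPf ((zeroOn Z M).submatrix (f ∘ g) (f ∘ g)))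
          (matrixPf (M.submatrix (f ∘ g) (f ∘ g)))
        have h1 := ih _ (f ∘ g) (hf.comp hg)
        have h2 := hK _ (f ∘ g) (hf.comp hg)
        linarith
      rw [add_sub_right_comm]
      refine (norm_add_le _ _).trans ((add_le_add b1 (b := _) (d := ‖M (f p) (f q)‖ * (K * Q)) ?_).trans
        (le_of_eq (by ring)))
      rw [norm_mul, norm_mul, hε, one_mul, norm_neg]
      gcongr
    · rw [elemSkew_submatrix_eq_zero h, add_zero]
      exact (ih _ f hf).trans hle

theorem prod_comp_pairs {n : ℕ} (v : Fin (2 * n) → ℂ) (π : Equiv.Perm (Fin (2 * n))) :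
    ∏ j : Fin n, (v (π (oddPos j)) * v (π (evenPos j))) = ∏ i, v i := by
  rw [← Equiv.prod_comp π v]
  set w := fun i => v (π i)
  have h := Fintype.prod_equiv (finProdFinEquiv (m := n) (n := 2))
    (fun k => w (Fin.cast (by omega) (finProdFinEquiv k)))
    (fun i => w (Fin.cast (by omega) i)) (fun k => rfl)
  rw [Fintype.prod_prod_type] at h
  have h2 := Fintype.prod_equiv (finCongr (show n * 2 = 2 * n by omega))
    (fun i => w (Fin.cast (by omega) i)) w (fun k => rfl)
  change _ = ∏ i, w i
  rw [← h2, ← h]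
  refine Finset.prod_congr rfl fun j _ => ?_
  rw [Fin.prod_univ_two]
  congr 2 <;> simp [oddPos, evenPos, finProdFinEquiv, add_comm]

/-- Conjugation of a matrix by a diagonal matrix multiplies the pfaffian by its determinant. -/
theorem matrixPf_diagonal_conj {n : ℕ} (v : Fin (2 * n) → ℂ)
    (M : Matrix (Fin (2 * n)) (Fin (2 * n)) ℂ) :
    matrixPf (Matrix.of fun p q => v p * v q * M p q) = (∏ i, v i) * matrixPf M := by
  unfold matrixPf
  rw [mul_left_comm, Finset.mul_sum _ _ (∏ i, v i)]
  refine congrArg (_ * ·) (Finset.sum_congr rfl fun π _ => ?_)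
  simp only [Matrix.of_apply]
  rw [Finset.prod_mul_distrib, prod_comp_pairs, mul_left_comm]

/-- The pfaffian of a matrix which splits into two blocks of odd size vanishes. -/
theorem matrixPf_zeroOn_prod_compl {n : ℕ} (M : Matrix (Fin (2 * n)) (Fin (2 * n)) ℂ)
    (J : Finset (Fin (2 * n))) (hJ : Odd J.card) : matrixPf (zeroOn (J ×ˢ Jᶜ) M) = 0 := by
  -- Flipping the signs of all indices in J fixes the decoupled matrix but multiplies its pfaffian
  -- by (-1)^|J| = -1.
  have h := matrixPf_diagonal_conj (fun i => if i ∈ J then -1 else 1) (zeroOn (J ×ˢ Jᶜ) M)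
  rw [Finset.prod_ite] at h
  simp only [Finset.prod_const, one_pow, mul_one, Finset.filter_mem_eq_inter,
    Finset.univ_inter, hJ.neg_one_pow] at h
  have h2 : (Matrix.of fun p q => (if p ∈ J then (-1 : ℂ) else 1) * (if q ∈ J then -1 else 1) *
      zeroOn (J ×ˢ Jᶜ) M p q) = zeroOn (J ×ˢ Jᶜ) M := by
    ext p q
    by_cases hp : p ∈ J <;> by_cases hq : q ∈ J <;> simp [zeroOn, hp, hq]
  rw [h2] at h
  linear_combination h / 2

/-- A pfaffian all of whose sub-pfaffians are bounded by `K` is small if the coupling between two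
odd blocks is small. -/
theorem norm_matrixPf_le_cross_sum {n : ℕ} {M : Matrix (Fin (2 * n)) (Fin (2 * n)) ℂ}
    (hM : ∀ p q, M p q = -M q p) {K : ℝ}
    (hK : ∀ (m : ℕ) (f : Fin (2 * m) → Fin (2 * n)), Function.Injective f →
      ‖matrixPf (M.submatrix f f)‖ ≤ K)
    (J : Finset (Fin (2 * n))) (hJ : Odd J.card) :
    ‖matrixPf M‖ ≤ K * (2 * ∑ z ∈ J ×ˢ Jᶜ, ‖M z.1 z.2‖) := by
  have h0 := hK n id Function.injective_id
  rw [Matrix.submatrix_id_id] at h0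
  have hK0 : 0 ≤ K := (norm_nonneg _).trans h0
  set X := ∑ z ∈ J ×ˢ Jᶜ, ‖M z.1 z.2‖ with hX
  have hX0 : 0 ≤ X := Finset.sum_nonneg fun _ _ => norm_nonneg _
  -- For X ≥ 1 the a priori bound K is already at most 2 K X. For X ≤ 1 one uses e^X - 1 ≤ 2 X.
  rcases le_total 1 X with h1 | h1
  · refine h0.trans ?_
    nlinarith
  · have h := norm_matrixPf_zeroOn_sub_le hM hK (J ×ˢ Jᶜ) (fun p q h => by
      simp only [Finset.mem_product, Finset.mem_compl] at h ⊢
      exact ⟨fun e => h.2 (e ▸ h.1), fun h' => h.2 h'.1⟩) Function.injective_id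
    rw [Matrix.submatrix_id_id, Matrix.submatrix_id_id, matrixPf_zeroOn_prod_compl M J hJ,
      zero_sub, norm_neg] at h
    refine h.trans (mul_le_mul_of_nonneg_left ?_ hK0)
    have h2 : ∏ z ∈ J ×ˢ Jᶜ, (1 + ‖M z.1 z.2‖) ≤ Real.exp X := by
      rw [hX, Real.exp_sum]
      refine Finset.prod_le_prod (fun _ _ => by positivity) fun z _ => ?_
      rw [add_comm]; exact Real.add_one_le_exp _
    have h3 := Real.abs_exp_sub_one_le (x := X) (by rwa [abs_of_nonneg hX0])
    rw [abs_of_nonneg hX0] at h3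
    linarith [le_abs_self (Real.exp X - 1)]

/-! ### Majorana fermions as self-adjoint involutions -/

theorem annSite_mul_self (x : ℤ) : annSite x * annSite x = 0 := by
  ext ψ S
  change annSite x (annSite x ψ) S = 0
  rw [annSite_apply, annSite_apply]
  simp

theorem c_delta_mul_self (x : ℤ) : c (delta x) * c (delta x) = 0 :=
  Subtype.ext (by simp [c, delta, ann_single, annSite_mul_self])

theorem c_delta_car (x : ℤ) :
    c (delta x) * star (c (delta x)) + star (c (delta x)) * c (delta x) = 1 :=
  Subtype.ext (by simpa [c, delta, ann_single] using annSite_car x x)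

theorem majorana_mul_self (x : ℤ) (σ : Flavor) : majorana x σ * majorana x σ = 1 := by
  have h1 := c_delta_mul_self x
  have h2 : star (c (delta x)) * star (c (delta x)) = 0 := by rw [← star_mul, h1, star_zero]
  have h3 := c_delta_car x
  cases σ with
  | plus =>
    simp only [majorana, add_mul, mul_add, h1, h2]
    rw [← h3]; abel
  | minus =>
    simp only [majorana, smul_mul_smul_comm, sub_mul, mul_sub, h1, h2, Complex.I_mul_I]
    rw [← h3, neg_smul, one_smul]; abel

theorem star_majorana (x : ℤ) (σ : Flavor) : star (majorana x σ) = majorana x σ := by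
  cases σ with
  | plus => simp [majorana, add_comm]
  | minus =>
    simp only [majorana, star_smul, star_sub, star_star]
    rw [← neg_sub (star (c (delta x))), smul_neg]
    simp

theorem evolved_mul_self (τ : ℝ → Alg ≃⋆ₐ[ℂ] Alg) (x : ℤ) (σ : Flavor) (t : ℝ) :
    evolved τ x σ t * evolved τ x σ t = 1 := by
  rw [evolved, ← map_mul, majorana_mul_self, map_one]

theorem norm_one_alg_le : ‖(1 : Alg)‖ ≤ 1 :=
  ContinuousLinearMap.norm_id_le (𝕜 := ℂ) (E := Fock)

/-- A *-automorphism preserves self-adjointness and the relation b² = 1, so the C*-identity gives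
‖b‖² = ‖1‖ ≤ 1. -/
theorem norm_evolved_le (τ : ℝ → Alg ≃⋆ₐ[ℂ] Alg) (x : ℤ) (σ : Flavor) (t : ℝ) :
    ‖evolved τ x σ t‖ ≤ 1 := by
  have h1 : star (evolved τ x σ t) = evolved τ x σ t := by
    rw [evolved, ← map_star, star_majorana]
  have h2 := evolved_mul_self τ x σ t
  set b := evolved τ x σ t
  have h3 : ‖(b : Fock →L[ℂ] Fock)‖ * ‖(b : Fock →L[ℂ] Fock)‖ = ‖(1 : Alg)‖ := by
    rw [← CStarRing.norm_star_mul_self, ← h2]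
    nth_rewrite 3 [← h1]
    rfl
  have h4 := norm_one_alg_le
  change ‖(b : Fock →L[ℂ] Fock)‖ ≤ 1
  nlinarith [norm_nonneg (b : Fock →L[ℂ] Fock)]

theorem norm_list_prod_le_one (l : List Alg) (h : ∀ a ∈ l, ‖a‖ ≤ 1) : ‖l.prod‖ ≤ 1 := by
  induction l with
  | nil => simpa using norm_one_alg_le
  | cons a l ih =>
    rw [List.prod_cons]
    refine (norm_mul_le _ _).trans (mul_le_one₀ (h a (by simp)) (norm_nonneg _)
      (ih fun b hb => h b (by simp [hb])))

/-! ### Consequences of the Wick relation -/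

theorem skew_antisymm {m : ℕ} (A : Fin m → Fin m → ℂ) (j k : Fin m) :
    skew A j k = -skew A k j := by
  rcases lt_trichotomy j k with h | rfl | h
  · simp [skew, h, h.not_gt]
  · simp [skew]
  · simp [skew, h, h.not_gt]

theorem skew_submatrix {m k : ℕ} (A : Fin m → Fin m → ℂ) {g : Fin k → Fin m}
    (hg : StrictMono g) : (skew A).submatrix g g = skew fun i j => A (g i) (g j) := by
  ext i j
  simp [skew, hg.lt_iff_lt]

theorem norm_matrixPf_submatrix_perm {n : ℕ} (M : Matrix (Fin (2 * n)) (Fin (2 * n)) ℂ)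
    (ρ : Equiv.Perm (Fin (2 * n))) : ‖matrixPf (M.submatrix ρ ρ)‖ = ‖matrixPf M‖ := by
  rw [matrixPf_submatrix_perm]
  rcases Int.units_eq_one_or (Equiv.Perm.sign ρ) with h | h <;> simp [h]

theorem matrixPf_of_size_zero (M : Matrix (Fin (2 * 0)) (Fin (2 * 0)) ℂ) : matrixPf M = 1 := by
  have : Subsingleton (Equiv.Perm (Fin (2 * 0))) := inferInstanceAs (Subsingleton (Equiv.Perm (Fin 0)))
  rw [matrixPf, Fintype.sum_subsingleton _ 1]
  simp

theorem matrixPf_zero {n : ℕ} (hn : 1 ≤ n) :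
    matrixPf (0 : Matrix (Fin (2 * n)) (Fin (2 * n)) ℂ) = 0 := by
  have : Nonempty (Fin n) := ⟨⟨0, hn⟩⟩
  simp [matrixPf, Finset.prod_const, Nat.one_le_iff_ne_zero.1 hn]

theorem norm_matrixPf_of_size_two {M : Matrix (Fin (2 * 1)) (Fin (2 * 1)) ℂ}
    (hM : ∀ p q, M p q = -M q p) {i l : Fin (2 * 1)} (hil : i ≠ l) : ‖matrixPf M‖ = ‖M i l‖ := by
  obtain ⟨g, ε, -, -, hε, h⟩ := exists_matrixPf_add_elemSkew (n := 0) hil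
  have h1 : M = 0 + elemSkew i l (M i l) := by
    have hd : ∀ p, M p p = 0 := fun p => by linear_combination hM p p / 2
    have hcase : ∀ p : Fin (2 * 1), p = i ∨ p = l := fun p => by omega
    ext p q
    rcases hcase p with rfl | rfl <;> rcases hcase q with rfl | rfl <;>
      simp [elemSkew, hd, hil, hil.symm]
    exact hM _ _
  have h2 := h 0 (M i l)
  rw [← h1, matrixPf_zero le_rfl, matrixPf_of_size_zero] at h2
  simp [h2, hε]

/-- Appending a Majorana fermion twice does not change the product, since its square is 1. In the
resulting 4 × 4 pfaffian the contractions with the two equal fermions cancel, leaving ω(1) times the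
two-point function up to sign. This makes the two-point function vanish as soon as |ω(1)| < 1. -/
theorem norm_twoPoint_eq {ω : Alg →ₗ[ℂ] ℂ} {τ : ℝ → Alg ≃⋆ₐ[ℂ] Alg} (h : IsQuasiFreePair ω τ)
    (x y : ℤ) (σ σ' : Flavor) (t s : ℝ) :
    ‖ω (evolved τ x σ t * evolved τ y σ' s)‖ =
      ‖ω 1‖ * ‖ω (evolved τ x σ t * evolved τ y σ' s)‖ := by
  let X : Fin (2 * 2) → ℤ := ![x, y, 0, 0]
  let S : Fin (2 * 2) → Flavor := ![σ, σ', .plus, .plus]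
  let T : Fin (2 * 2) → ℝ := ![t, s, 0, 0]
  have h1 := h 2 (by norm_num) X S T
  have h2 : (List.ofFn fun j => evolved τ (X j) (S j) (T j)).prod =
      evolved τ x σ t * evolved τ y σ' s := by
    change (List.ofFn (n := 4) fun j => evolved τ (X j) (S j) (T j)).prod = _
    simp only [List.ofFn_succ, List.ofFn_zero, List.prod_cons, List.prod_nil, mul_one]
    change evolved τ x σ t * (evolved τ y σ' s *
      (evolved τ 0 .plus 0 * evolved τ 0 .plus 0)) = _
    rw [evolved_mul_self, mul_one]
  rw [h2, corrPf, pf_eq_matrixPf] at h1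
  set A : Fin (2 * 2) → Fin (2 * 2) → ℂ := fun j k =>
    ω (evolved τ (X j) (S j) (T j) * evolved τ (X k) (S k) (T k)) with hA
  let i : Fin (2 * 2) := (2 : Fin 4)
  let l : Fin (2 * 2) := (3 : Fin 4)
  have hil : i ≠ l := by decide
  have hw : skew A i l = ω 1 := by
    have : i < l := by decide
    simp only [skew, Matrix.of_apply, this, if_true, hA]
    exact congrArg ω (evolved_mul_self τ 0 .plus 0)
  have hXS : ∀ j, evolved τ (X (Equiv.swap i l j)) (S (Equiv.swap i l j)) (T (Equiv.swap i l j)) =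
      evolved τ (X j) (S j) (T j) := by
    intro j
    change Fin 4 at j
    fin_cases j <;> rfl
  -- Exchanging the two equal fermions changes only their mutual entry, from ω(1) to -ω(1).
  have hsw : (skew A).submatrix (Equiv.swap i l) (Equiv.swap i l) =
      skew A + elemSkew i l (-2 * ω 1) := by
    ext p q
    have hA' : ∀ p q, A (Equiv.swap i l p) (Equiv.swap i l q) = A p q := fun p q => by
      simp only [hA, hXS]
    have hil' : skew A l i = -ω 1 := by rw [skew_antisymm, hw]
    by_cases h1 : p = i ∧ q = l
    · obtain ⟨rfl, rfl⟩ := h1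
      simp [elemSkew, hw, hil']
      ring
    · by_cases h2 : p = l ∧ q = i
      · obtain ⟨rfl, rfl⟩ := h2
        simp [elemSkew, hw, hil', hil, hil.symm]
        ring
      · have h3 : Equiv.swap i l p < Equiv.swap i l q ↔ p < q := by
          revert p q; decide
        have h4 : Equiv.swap i l q < Equiv.swap i l p ↔ q < p := by
          revert p q; decide
        simp [skew, elemSkew, h1, h2, hA', h3, h4]
  obtain ⟨g, ε, hg, hgil, hε, hpf⟩ := exists_matrixPf_add_elemSkew (n := 1) hil
  have h5 := matrixPf_submatrix_perm (skew A) (Equiv.swap i l)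
  rw [hsw, hpf, Equiv.Perm.sign_swap hil] at h5
  -- The swap is odd, so `h5` reads pf - 2 ε ω(1) pf' = -pf.
  have h6 : matrixPf (skew A) = ε * ω 1 * matrixPf ((skew A).submatrix g g) := by
    push_cast at h5
    linear_combination h5 / 2
  let a : Fin (2 * 1) := (0 : Fin 2)
  let b : Fin (2 * 1) := (1 : Fin 2)
  have hab : a ≠ b := by decide
  have h7 := norm_matrixPf_of_size_two (M := (skew A).submatrix g g)
    (fun p q => skew_antisymm A _ _) hab
  let a' : Fin (2 * 2) := (0 : Fin 4)
  let b' : Fin (2 * 2) := (1 : Fin 4)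
  have h01 : ‖skew A (g a) (g b)‖ = ‖skew A a' b'‖ := by
    have hcase : ∀ u v : Fin (2 * 2), u ≠ v → (u ≠ i ∧ u ≠ l) → (v ≠ i ∧ v ≠ l) →
        (u = a' ∧ v = b') ∨ (u = b' ∧ v = a') := by decide
    rcases hcase _ _ (hg.ne hab) (hgil a) (hgil b) with ⟨h1, h2⟩ | ⟨h1, h2⟩
    · rw [h1, h2]
    · rw [h1, h2, skew_antisymm, norm_neg]
  have h8 : skew A a' b' = ω (evolved τ x σ t * evolved τ y σ' s) := by
    have : a' < b' := by decide
    simp only [skew, Matrix.of_apply, this, if_true, hA]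
    rfl
  rw [Matrix.submatrix_apply, h01, h8] at h7
  calc ‖ω (evolved τ x σ t * evolved τ y σ' s)‖ = ‖matrixPf (skew A)‖ := by rw [h1]
    _ = _ := by rw [h6, norm_mul, norm_mul, hε, h7, one_mul]

/-- All sub-pfaffians of a time-dependent two-point function are bounded. -/
theorem norm_matrixPf_submatrix_le {ω : Alg →ₗ[ℂ] ℂ} {τ : ℝ → Alg ≃⋆ₐ[ℂ] Alg}
    (h : IsQuasiFreePair ω τ) {K : ℝ} (hK : 1 ≤ K) (hω : ∀ A, ‖ω A‖ ≤ K * ‖A‖) {n : ℕ}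
    (x : Fin n → ℤ) (σ : Fin n → Flavor) (t : Fin n → ℝ) (m : ℕ) (f : Fin (2 * m) → Fin n)
    (hf : Function.Injective f) :
    ‖matrixPf ((skew fun j k => ω (evolved τ (x j) (σ j) (t j) *
      evolved τ (x k) (σ k) (t k))).submatrix f f)‖ ≤ K := by
  rcases Nat.eq_zero_or_pos m with rfl | hm
  · rwa [matrixPf_of_size_zero, norm_one]
  -- Sorting costs only a sign, and an increasing choice of indices yields the array of a smaller
  -- list of fermions, to which the Wick relation applies.
  have hg : StrictMono (f ∘ Tuple.sort f) :=
    (Tuple.monotone_sort f).strictMono_of_injective (hf.comp (Equiv.injective _))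
  rw [← norm_matrixPf_submatrix_perm _ (Tuple.sort f), Matrix.submatrix_submatrix,
    skew_submatrix _ hg]
  have h1 := h m hm (fun j => x ((f ∘ Tuple.sort f) j)) (fun j => σ ((f ∘ Tuple.sort f) j))
    (fun j => t ((f ∘ Tuple.sort f) j))
  rw [corrPf, pf_eq_matrixPf] at h1
  rw [← h1]
  refine (hω _).trans (mul_le_of_le_one_right (zero_le_one.trans hK)
    (norm_list_prod_le_one _ fun a ha => ?_))
  obtain ⟨j, rfl⟩ := (List.mem_ofFn' _ _).1 ha
  exact norm_evolved_le _ _ _ _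

/-- The pfaffian of the two-point function is small if the coupling between two odd groups of
fermions is small. -/
theorem norm_corrPf_le_cross_sum {ω : Alg →ₗ[ℂ] ℂ} {τ : ℝ → Alg ≃⋆ₐ[ℂ] Alg}
    (h : IsQuasiFreePair ω τ) {K : ℝ} (hK : 0 < K) (hω : ∀ A, ‖ω A‖ ≤ K * ‖A‖) {n : ℕ}
    (hn : 1 ≤ n) (x : Fin (2 * n) → ℤ) (σ : Fin (2 * n) → Flavor) (t : Fin (2 * n) → ℝ)
    (J : Finset (Fin (2 * n))) (hJ : Odd J.card) :
    ‖corrPf ω τ x σ t‖ ≤ K * (2 * ∑ z ∈ J ×ˢ Jᶜ, ‖skew (fun j k =>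
      ω (evolved τ (x j) (σ j) (t j) * evolved τ (x k) (σ k) (t k))) z.1 z.2‖) := by
  rcases le_or_gt 1 K with h1 | h1
  · exact norm_matrixPf_le_cross_sum (skew_antisymm _)
      (norm_matrixPf_submatrix_le h h1 hω x σ t) J hJ
  · have hlt : ‖ω 1‖ < 1 := (hω 1).trans_lt
      ((mul_le_of_le_one_right hK.le norm_one_alg_le).trans_lt h1)
    have h0 : ∀ j k, ω (evolved τ (x j) (σ j) (t j) * evolved τ (x k) (σ k) (t k)) = 0 := by
      intro j k
      have := norm_twoPoint_eq h (x j) (x k) (σ j) (σ k) (t j) (t k)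
      rw [← norm_eq_zero]
      nlinarith [norm_nonneg (ω (evolved τ (x j) (σ j) (t j) * evolved τ (x k) (σ k) (t k)))]
    have hz : skew (fun j k => ω (evolved τ (x j) (σ j) (t j) *
        evolved τ (x k) (σ k) (t k))) = 0 := by
      ext j k; simp [skew, h0]
    rw [corrPf, pf_eq_matrixPf, hz, matrixPf_zero hn, norm_zero]
    positivity

/-! ### Monotonicity and subadditivity of the outer expectation -/

section Expect

variable {Ω : Type*} [MeasurableSpace Ω] {P : Measure Ω}

/-- A measurable majorant of g becomes one of f when set to ∞ on a measurable null set, without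
changing its integral. -/
theorem expect_mono_ae {f g : Ω → ℝ≥0∞} (h : ∀ᵐ p ∂P, f p ≤ g p) : expect P f ≤ expect P g := by
  refine le_iInf fun G => le_iInf fun hG => le_iInf fun hgG => ?_
  obtain ⟨N, hN, hNm, hN0⟩ := exists_measurable_superset_of_null h
  classical
  have hm : Measurable (N.piecewise (fun _ => ∞) G) := Measurable.piecewise hNm measurable_const hG
  refine (iInf₂_le_of_le _ hm (iInf_le _ fun p => ?_)).trans (le_of_eq (lintegral_congr_ae ?_))
  · by_cases hp : p ∈ N
    · simp [hp]
    · have : f p ≤ g p := by by_contra h1; exact hp (hN h1)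
      simpa [hp] using this.trans (hgG p)
  · filter_upwards [measure_eq_zero_iff_ae_notMem.1 hN0] with p hp
    simp [hp]

theorem expect_add_le (f g : Ω → ℝ≥0∞) :
    expect P (fun p => f p + g p) ≤ expect P f + expect P g := by
  simp_rw [expect, ENNReal.iInf_add, ENNReal.add_iInf]
  refine le_iInf fun F => le_iInf fun hF => le_iInf fun hfF => le_iInf fun G => le_iInf fun hG =>
    le_iInf fun hgG => ?_
  rw [← lintegral_add_left hF]
  exact iInf₂_le_of_le _ (hF.add hG) (iInf_le _ fun p => add_le_add (hfF p) (hgG p))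

theorem expect_zero : expect P (fun _ => 0) = 0 := by
  rw [expect_eq_lintegral P aemeasurable_const, lintegral_zero]

theorem expect_sum_le {ι : Type*} (s : Finset ι) (f : ι → Ω → ℝ≥0∞) :
    expect P (fun p => ∑ z ∈ s, f z p) ≤ ∑ z ∈ s, expect P (f z) := by
  classical
  induction s using Finset.induction_on with
  | empty => simp [expect_zero]
  | insert z s hz ih =>
    simp_rw [Finset.sum_insert hz]
    exact (expect_add_le _ _).trans (by gcongr)

end Expect

/-! ### Splitting the configuration at its largest gap -/

theorem sum_pow_le_of_injOn {ι : Type*} (s : Finset ι) (k : ι → ℕ) (hk : Set.InjOn k s) {q : ℝ}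
    (hq0 : 0 ≤ q) (hq1 : q < 1) : ∑ i ∈ s, q ^ k i ≤ (1 - q)⁻¹ := by
  classical
  rw [← Finset.sum_image (f := fun m => q ^ m) hk, ← tsum_geometric_of_lt_one hq0 hq1]
  exact (summable_geometric_of_lt_one hq0 hq1).sum_le_tsum _ fun _ _ => by positivity

/-- Each value of k occurs at most once per flavour, so two geometric series dominate, independently
of the size of s. -/
theorem sum_exp_neg_le {ι : Type*} (s : Finset ι) (k : ι → ℕ) (σ : ι → Flavor)
    (hk : Set.InjOn (fun i => (k i, σ i)) s) {μ : ℝ} (hμ : 0 < μ) :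
    ∑ i ∈ s, Real.exp (-μ * k i) ≤ 2 * (1 - Real.exp (-μ))⁻¹ := by
  classical
  have h : ∀ i, Real.exp (-μ * k i) = Real.exp (-μ) ^ k i := fun i => by
    rw [← Real.exp_nat_mul, mul_comm]
  simp_rw [h]
  have hq1 : Real.exp (-μ) < 1 := by rw [Real.exp_lt_one_iff]; linarith
  rw [← Finset.sum_filter_add_sum_filter_not s (fun i => σ i = .plus), two_mul]
  refine add_le_add (sum_pow_le_of_injOn _ _ ?_ (Real.exp_pos _).le hq1)
    (sum_pow_le_of_injOn _ _ ?_ (Real.exp_pos _).le hq1)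
  · intro i hi j hj hij
    simp only [Finset.coe_filter, Set.mem_ofPred_eq] at hi hj
    exact hk hi.1 hj.1 (Prod.ext hij (hi.2.trans hj.2.symm))
  · intro i hi j hj hij
    simp only [Finset.coe_filter, Set.mem_ofPred_eq] at hi hj
    refine hk hi.1 hj.1 (Prod.ext hij ?_)
    change σ i = σ j
    cases h1 : σ i <;> cases h2 : σ j <;> simp_all

/-- The largest gap `r x` splits the configuration into two odd groups whose coupling decays
exponentially in `r x`. -/
theorem exists_odd_splitting {n : ℕ} (hn : 1 ≤ n) (x : Fin (2 * n) → ℤ)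
    (σ : Fin (2 * n) → Flavor) (hx : IsMajoranaConfig x σ) {μ : ℝ} (hμ : 0 < μ) :
    ∃ J : Finset (Fin (2 * n)), Odd J.card ∧
      ∑ z ∈ J ×ˢ Jᶜ, Real.exp (-μ * ((|x z.1 - x z.2| : ℤ) : ℝ)) ≤
        (2 * (1 - Real.exp (-μ))⁻¹) ^ 2 * Real.exp (-μ * (r x : ℝ)) := by
  have : Nonempty (Fin n) := ⟨⟨0, hn⟩⟩
  obtain ⟨j, -, hj⟩ := Finset.exists_mem_eq_sup Finset.univ Finset.univ_nonempty fun j : Fin n =>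
    (x (Tuple.sort x (evenPos j)) - x (Tuple.sort x (oddPos j))).natAbs
  change r x = _ at hj
  have hmono : Monotone (x ∘ Tuple.sort x) := Tuple.monotone_sort x
  set p := x (Tuple.sort x (oddPos j)) with hp
  set q := x (Tuple.sort x (evenPos j)) with hq
  have hpq : p ≤ q := hmono (by simp only [oddPos, evenPos, Fin.le_def]; omega)
  -- The fermions to the left of the gap. With j counted from 0 there are 2j + 1 of them, an odd
  -- number.
  set J := (Finset.Iic (oddPos j)).map (Tuple.sort x).toEmbedding with hJ
  have hJmem : ∀ i, i ∈ J ↔ (Tuple.sort x).symm i ≤ oddPos j := fun i => by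
    rw [hJ, Finset.mem_map_equiv, Finset.mem_Iic]
  have hle : ∀ i ∈ J, x i ≤ p := fun i hi => by
    simpa using hmono ((hJmem i).1 hi)
  have hge : ∀ i ∈ Jᶜ, q ≤ x i := fun i hi => by
    rw [Finset.mem_compl, hJmem, not_le] at hi
    have : evenPos j ≤ (Tuple.sort x).symm i := by
      simp only [oddPos, evenPos, Fin.lt_def, Fin.le_def] at hi ⊢; omega
    simpa using hmono this
  refine ⟨J, ?_, ?_⟩
  · rw [hJ, Finset.card_map, Fin.card_Iic]
    exact ⟨j, rfl⟩
  · have hterm : ∀ z ∈ J ×ˢ Jᶜ, Real.exp (-μ * ((|x z.1 - x z.2| : ℤ) : ℝ)) =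
        Real.exp (-μ * (r x : ℝ)) * (Real.exp (-μ * ((p - x z.1).toNat : ℝ)) *
          Real.exp (-μ * ((x z.2 - q).toNat : ℝ))) := by
      intro z hz
      rw [Finset.mem_product] at hz
      have h1 := hle _ hz.1
      have h2 := hge _ hz.2
      rw [← Real.exp_add, ← Real.exp_add, ← mul_add, ← mul_add]
      congr 2
      -- The gap [p, q] lies between the two sites, so the distance is additive and the double sum
      -- factorises.
      have : |x z.1 - x z.2| = (r x : ℤ) + (((p - x z.1).toNat : ℤ) + ((x z.2 - q).toNat : ℤ)) := by
        rw [hj, abs_of_nonpos (by omega)]; omega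
      rw [this]; push_cast; rfl
    rw [Finset.sum_congr rfl hterm, ← Finset.mul_sum, Finset.sum_product]
    dsimp only
    rw [← Finset.sum_mul_sum, mul_comm, sq]
    refine mul_le_mul_of_nonneg_right (mul_le_mul ?_ ?_ (Finset.sum_nonneg fun _ _ => by positivity)
      ?_) (Real.exp_pos _).le
    · refine sum_exp_neg_le J _ σ (fun i hi l hl hil => hx ?_) hμ
      have h1 := hle _ hi
      have h2 := hle _ hl
      simp only [Prod.mk.injEq] at hil ⊢
      exact ⟨by omega, hil.2⟩
    · refine sum_exp_neg_le Jᶜ _ σ (fun i hi l hl hil => hx ?_) hμ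
      have h1 := hge _ hi
      have h2 := hge _ hl
      simp only [Prod.mk.injEq] at hil ⊢
      exact ⟨by omega, hil.2⟩
    · have : Real.exp (-μ) < 1 := by rw [Real.exp_lt_one_iff]; linarith
      have := sub_pos.2 this
      positivity

/-! ### Suprema over times and the final estimate -/

/-- The supremum over times in `I` of the modulus of a two-point function. -/
def supTwoPoint (ω : Alg →ₗ[ℂ] ℂ) (τ : ℝ → Alg ≃⋆ₐ[ℂ] Alg) (I : Set ℝ) (x y : ℤ)
    (σ σ' : Flavor) : ℝ≥0∞ :=
  ⨆ (s : I) (t : I), ‖ω (evolved τ x σ t * evolved τ y σ' s)‖ₑ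

/-- The two-point function of a pair of positions, taken in the order of the positions. -/
def supPair (ω : Alg →ₗ[ℂ] ℂ) (τ : ℝ → Alg ≃⋆ₐ[ℂ] Alg) (I : Set ℝ) {m : ℕ} (x : Fin m → ℤ)
    (σ : Fin m → Flavor) (z : Fin m × Fin m) : ℝ≥0∞ :=
  if z.1 < z.2 then supTwoPoint ω τ I (x z.1) (x z.2) (σ z.1) (σ z.2)
  else supTwoPoint ω τ I (x z.2) (x z.1) (σ z.2) (σ z.1)

theorem enorm_skew_le_supPair (ω : Alg →ₗ[ℂ] ℂ) (τ : ℝ → Alg ≃⋆ₐ[ℂ] Alg) (I : Set ℝ) {m : ℕ}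
    (x : Fin m → ℤ) (σ : Fin m → Flavor) (t : Fin m → I) (z : Fin m × Fin m) :
    ‖skew (fun j k => ω (evolved τ (x j) (σ j) (t j) * evolved τ (x k) (σ k) (t k))) z.1 z.2‖ₑ ≤
      supPair ω τ I x σ z := by
  unfold supPair supTwoPoint skew
  rw [Matrix.of_apply]
  split_ifs with h1 h2
  · exact le_iSup₂_of_le (t z.2) (t z.1) le_rfl
  · rw [enorm_neg]
    exact le_iSup₂_of_le (t z.1) (t z.2) le_rfl
  · simp

/-- The cross-sum bound is linear in K, so the normalisation removes K. The factor 2 is written as a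
sum of two equal terms, so that subadditivity of `expect` suffices afterwards. -/
theorem iSup_corrPf_le {ω : Alg →ₗ[ℂ] ℂ} {τ : ℝ → Alg ≃⋆ₐ[ℂ] Alg}
    (h : IsQuasiFreePair ω τ) {K : ℝ} (hK : 0 < K) (hω : ∀ A, ‖ω A‖ ≤ K * ‖A‖) (I : Set ℝ) {n : ℕ}
    (hn : 1 ≤ n) (x : Fin (2 * n) → ℤ) (σ : Fin (2 * n) → Flavor)
    (J : Finset (Fin (2 * n))) (hJ : Odd J.card) :
    ⨆ t : Fin (2 * n) → I, (ENNReal.ofReal K)⁻¹ * ‖corrPf ω τ x σ (fun j => (t j : ℝ))‖ₑ ≤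
      ∑ z ∈ J ×ˢ Jᶜ, (supPair ω τ I x σ z + supPair ω τ I x σ z) := by
  refine iSup_le fun t => ?_
  have h1 := norm_corrPf_le_cross_sum h hK hω hn x σ (fun j => (t j : ℝ)) J hJ
  have hK' : ENNReal.ofReal K ≠ 0 := by simpa using hK
  rw [mul_comm, ← div_eq_mul_inv]
  refine ENNReal.div_le_of_le_mul' ?_
  rw [← ofReal_norm]
  refine (ENNReal.ofReal_le_ofReal h1).trans ?_
  rw [ENNReal.ofReal_mul hK.le]
  gcongr
  rw [Finset.mul_sum, ENNReal.ofReal_sum_of_nonneg fun _ _ => by positivity]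
  refine Finset.sum_le_sum fun z _ => ?_
  rw [two_mul, ENNReal.ofReal_add (norm_nonneg _) (norm_nonneg _), ofReal_norm]
  exact add_le_add (enorm_skew_le_supPair _ _ _ _ _ _ _) (enorm_skew_le_supPair _ _ _ _ _ _ _)

end CAR

end

theorem theorem4 (C μ : ℝ) (hC : 0 < C) (hμ : 0 < μ) :
    ∃ C' : ℝ, 0 < C' ∧
      ∀ {Ω : Type*} [MeasurableSpace Ω] (P : Measure Ω) [IsProbabilityMeasure P]
        (ω : Ω → CAR.Alg →ₗ[ℂ] ℂ) (τ : Ω → ℝ → CAR.Alg ≃⋆ₐ[ℂ] CAR.Alg) (M₀ : Ω → ℝ) (I : Set ℝ),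
        (∀ᵐ p ∂P, CAR.IsQuasiFreePair (ω p) (τ p)) →
        (∀ᵐ p ∂P, 0 < M₀ p ∧ ∀ A : CAR.Alg, ‖ω p A‖ ≤ M₀ p * ‖A‖) →
        (∀ (x y : ℤ) (σ σ' : CAR.Flavor),
          CAR.expect P (fun p => ⨆ (s : I) (t : I),
            ‖ω p (CAR.evolved (τ p) x σ t * CAR.evolved (τ p) y σ' s)‖ₑ) ≤
          ENNReal.ofReal (C * Real.exp (-μ * ((|x - y| : ℤ) : ℝ)))) →
        ∀ (n : ℕ), 1 ≤ n → ∀ (x : Fin (2 * n) → ℤ) (σ : Fin (2 * n) → CAR.Flavor),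
          CAR.IsMajoranaConfig x σ →
          CAR.expect P (fun p => ⨆ t : Fin (2 * n) → I,
            (ENNReal.ofReal (M₀ p))⁻¹ * ‖CAR.corrPf (ω p) (τ p) x σ (fun j => (t j : ℝ))‖ₑ) ≤
          ENNReal.ofReal (C' * Real.exp (-μ * (CAR.r x : ℝ) / 3)) := by
  have hq : 0 < 1 - Real.exp (-μ) := sub_pos.2 (by rw [Real.exp_lt_one_iff]; linarith)
  -- The factor 2 comes from e^X - 1 ≤ 2 X, C from the decay hypothesis, and the square from the
  -- lattice sums on the two sides of the gap.
  refine ⟨2 * C * (2 * (1 - Real.exp (-μ))⁻¹) ^ 2, by positivity, ?_⟩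
  intro Ω _ P _ ω τ M₀ I hqf hb hdec n hn x σ hx
  obtain ⟨J, hJ, hsum⟩ := CAR.exists_odd_splitting hn x σ hx hμ
  have hpair : ∀ z : Fin (2 * n) × Fin (2 * n),
      CAR.expect P (fun p => CAR.supPair (ω p) (τ p) I x σ z) ≤
        ENNReal.ofReal (C * Real.exp (-μ * ((|x z.1 - x z.2| : ℤ) : ℝ))) := by
    intro z
    by_cases hz : z.1 < z.2
    · simp only [CAR.supPair, hz, if_true]
      exact hdec _ _ _ _
    · simp only [CAR.supPair, hz, if_false]
      rw [abs_sub_comm]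
      exact hdec _ _ _ _
  calc CAR.expect P (fun p => ⨆ t : Fin (2 * n) → I,
          (ENNReal.ofReal (M₀ p))⁻¹ * ‖CAR.corrPf (ω p) (τ p) x σ (fun j => (t j : ℝ))‖ₑ)
      ≤ CAR.expect P (fun p => ∑ z ∈ J ×ˢ Jᶜ,
          (CAR.supPair (ω p) (τ p) I x σ z + CAR.supPair (ω p) (τ p) I x σ z)) := by
        refine CAR.expect_mono_ae ?_
        filter_upwards [hqf, hb] with p h1 h2
        exact CAR.iSup_corrPf_le h1 h2.1 h2.2 I hn x σ J hJ
    _ ≤ ∑ z ∈ J ×ˢ Jᶜ, ENNReal.ofReal (2 * C * Real.exp (-μ * ((|x z.1 - x z.2| : ℤ) : ℝ))) := by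
        refine (CAR.expect_sum_le _ _).trans (Finset.sum_le_sum fun z _ => ?_)
        refine (CAR.expect_add_le _ _).trans ((add_le_add (hpair z) (hpair z)).trans (le_of_eq ?_))
        rw [← ENNReal.ofReal_add (by positivity) (by positivity)]
        congr 1
        ring
    _ = ENNReal.ofReal (2 * C * ∑ z ∈ J ×ˢ Jᶜ, Real.exp (-μ * ((|x z.1 - x z.2| : ℤ) : ℝ))) := by
        rw [Finset.mul_sum, ENNReal.ofReal_sum_of_nonneg fun _ _ => by positivity]
    _ ≤ _ := by
        refine ENNReal.ofReal_le_ofReal ?_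
        rw [mul_assoc (2 * C)]
        refine mul_le_mul_of_nonneg_left (hsum.trans ?_) (by positivity)
        -- The argument yields the full rate μ; it is weakened to μ/3 here.
        refine mul_le_mul_of_nonneg_left (Real.exp_le_exp.2 ?_) (by positivity)
        have : 0 ≤ μ * (CAR.r x : ℝ) := by positivity
        linarith
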